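/- Let $H$ be a real Hilbert space with inner product $\langle\cdot,\cdot\rangle$ and norm $|\cdot|$. Let $B$ be a self-adjoint linear operator on $H$ with dense domain $D(B)$ which is coercive, i.e. for some $b>0$ we have $\langle Bv,v\rangle\ge b|v|^2$ for all $v\in D(B)$. Let $V:=D(B^{1/2})$, with norm $\|v\|:=|B^{1/2}v|$ and dual $V'$ (where $V\subset H\subset V'$), and denote also by $B$ the extension $V\to V'$ given by $\langle Bv,w\rangle=\langle B^{1/2}v,B^{1/2}w\rangle$ for $v,w\in V$. Let $A\in L^\infty(\mathbb R^+,L(H))$ and $\gamma\in L(H)$, and put $$\|A\|:=\operatorname*{ess\,sup}_{t\ge 0}\|A(t)\|_{L(H)},\qquad \Gamma:=\|\gamma\|_{L(H)}.$$ Assume that $\langle\gamma v,v\rangle\ge c|v|^2$ for all $v\in V$, with a constant $c>0$; that $\gamma\in L(V)$, i.e. $\gamma$ maps $V$ into $V$ and is bounded for the norm of $V$; and that for some constants $\rho,\eta>0$ $$\langle Bv,\gamma v\rangle\ \ge\ \rho|v|^2+\eta\|v\|^2\qquad\text{for all } v\in V .$$ Assume finally that $$\|A\|<\sqrt{c\rho+\tfrac{c^2}{4}\Gamma^2}-\tfrac{c}{2}\Gamma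 .$$ A mild solution of $$u''(t)+[B+A(t)]u(t)+\gamma u'(t)=0,\qquad t\ge 0,$$ is a function $u\in C(\mathbb R^+,V)\cap C^1(\mathbb R^+,H)$ such that $u'(t)=u'(0)-\int_0^t\big(Bu+Au+\gamma u'\big)\,d\tau$ in $V'$ for all $t\ge0$ (equivalently, $u\in W^{2,\infty}_{loc}(\mathbb R^+,V')$ and the equation holds in $V'$ for almost every $t$). Then there are $\delta>0$ and $M>0$ such that every mild solution $u$ (with arbitrary initial data $u(0)\in V$, $u'(0)\in H$) satisfies $$\|u(t)\|^2+|u'(t)|^2\ \le\ M\big[\|u(s)\|^2+|u'(s)|^2\big]\,e^{-\delta(t-s)}\qquad\text{whenever } 0\le s\le t .$$ -/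

import Mathlib

open MeasureTheory Set Filter Topology
open scoped RealInnerProductSpace

namespace HilbertEvolution

section SquareRoot

variable {H : Type*} [NormedAddCommGroup H] [InnerProductSpace ℝ H] [CompleteSpace H]

/-- `S` is the positive square root of the (possibly unbounded) operator `B`: `S` is self-adjoint
and nonnegative, and `S ∘ S = B` as partially defined operators, that is, `B x = z` holds if and
only if `S x = y` and `S y = z` for some `y` (domains included). -/
structure IsPosSqrt (S B : H →ₗ.[ℝ] H) : Prop where
  selfAdjoint : IsSelfAdjoint S
  nonneg : ∀ x : S.domain, 0 ≤ ⟪S x, (x : H)⟫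
  comp_self : ∀ x z : H, (x, z) ∈ B.graph ↔ ∃ y, (x, y) ∈ S.graph ∧ (y, z) ∈ S.graph

/-- `B` is coercive: `⟨B v, v⟩ ≥ b |v|²` for all `v ∈ D(B)` and some `b > 0`. -/
def IsCoerciveOp (B : H →ₗ.[ℝ] H) : Prop :=
  ∃ b : ℝ, 0 < b ∧ ∀ v : B.domain, b * ‖(v : H)‖ ^ 2 ≤ ⟪B v, (v : H)⟫

/-- The iteration `Y ↦ (X + Y²) / 2`, converging to `1 - √(1 - X)`. -/
noncomputable def sqrtIter {R : Type*} [NormedRing R] [NormedAlgebra ℝ R] (X : R) : ℕ → R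
  | 0 => 0
  | n + 1 => (2⁻¹ : ℝ) • (X + sqrtIter X n * sqrtIter X n)

theorem sqrtIter_real_bounds (n : ℕ) : 0 ≤ sqrtIter (1 : ℝ) n ∧ sqrtIter (1 : ℝ) n ≤ 1 := by
  induction n with
  | zero => simp [sqrtIter]
  | succ n ih =>
    simp only [sqrtIter, smul_eq_mul]
    constructor <;> nlinarith [ih.1, ih.2]

theorem sqrtIter_norm_le {R : Type*} [NormedRing R] [NormedAlgebra ℝ R] {X : R} (hX : ‖X‖ ≤ 1)
    (n : ℕ) : ‖sqrtIter X n‖ ≤ sqrtIter (1 : ℝ) n := by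
  induction n with
  | zero => simp [sqrtIter]
  | succ n ih =>
    simp only [sqrtIter, smul_eq_mul]
    rw [norm_smul, Real.norm_of_nonneg (by norm_num)]
    have h1 := norm_add_le X (sqrtIter X n * sqrtIter X n)
    have h2 := norm_mul_le (sqrtIter X n) (sqrtIter X n)
    have h3 := mul_self_le_mul_self (norm_nonneg _) ih
    nlinarith

theorem sqrtIter_diff_le {R : Type*} [NormedRing R] [NormedAlgebra ℝ R] {X : R} (hX : ‖X‖ ≤ 1)
    (n : ℕ) : ‖sqrtIter X (n + 1) - sqrtIter X n‖ ≤
      sqrtIter (1 : ℝ) (n + 1) - sqrtIter (1 : ℝ) n := by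
  induction n with
  | zero =>
    simp only [sqrtIter, mul_zero, add_zero, sub_zero, smul_eq_mul, mul_one]
    rw [norm_smul, Real.norm_of_nonneg (by norm_num)]
    linarith
  | succ n ih =>
    have e : sqrtIter X (n + 1 + 1) - sqrtIter X (n + 1) =
        (2⁻¹ : ℝ) • (sqrtIter X (n + 1) * (sqrtIter X (n + 1) - sqrtIter X n) +
          (sqrtIter X (n + 1) - sqrtIter X n) * sqrtIter X n) := by
      conv_lhs => rw [sqrtIter]
      conv_lhs => arg 2; rw [sqrtIter]
      rw [← smul_sub]
      congr 1
      noncomm_ring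
    have e' : sqrtIter (1 : ℝ) (n + 1 + 1) - sqrtIter (1 : ℝ) (n + 1) =
        2⁻¹ * ((sqrtIter (1 : ℝ) (n + 1) - sqrtIter (1 : ℝ) n) *
          (sqrtIter (1 : ℝ) (n + 1) + sqrtIter (1 : ℝ) n)) := by
      conv_lhs => rw [sqrtIter]
      conv_lhs => arg 2; rw [sqrtIter]
      simp only [smul_eq_mul]
      ring
    rw [e, e', norm_smul, Real.norm_of_nonneg (by norm_num)]
    have h1 := norm_add_le (sqrtIter X (n + 1) * (sqrtIter X (n + 1) - sqrtIter X n))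
      ((sqrtIter X (n + 1) - sqrtIter X n) * sqrtIter X n)
    have h2 := norm_mul_le (sqrtIter X (n + 1)) (sqrtIter X (n + 1) - sqrtIter X n)
    have h3 := norm_mul_le (sqrtIter X (n + 1) - sqrtIter X n) (sqrtIter X n)
    have h4 := mul_le_mul (sqrtIter_norm_le hX (n + 1)) ih (norm_nonneg _)
      (sqrtIter_real_bounds (n + 1)).1
    have h5 := mul_le_mul ih (sqrtIter_norm_le hX n) (norm_nonneg _)
      ((norm_nonneg _).trans ih)
    nlinarith

theorem sqrtIter_tendsto {R : Type*} [NormedRing R] [NormedAlgebra ℝ R] [CompleteSpace R] {X : R}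
    (hX : ‖X‖ ≤ 1) : ∃ Y : R, Tendsto (sqrtIter X) atTop (𝓝 Y) ∧ ‖Y‖ ≤ 1 ∧
      (1 - Y) * (1 - Y) = 1 - X := by
  have hmono : Monotone (sqrtIter (1 : ℝ)) := monotone_nat_of_le_succ fun n => by
    have := (norm_nonneg _).trans (sqrtIter_diff_le hX n)
    linarith
  have hsum : Summable fun n => sqrtIter (1 : ℝ) (n + 1) - sqrtIter (1 : ℝ) n := by
    refine summable_of_sum_range_le (c := 1) (fun n => ?_) (fun n => ?_)
    · exact sub_nonneg.2 (hmono n.le_succ)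
    · rw [Finset.sum_range_sub]
      have := (sqrtIter_real_bounds n).2
      simp only [sqrtIter] at *
      linarith
  have hc : CauchySeq (sqrtIter X) := by
    refine cauchySeq_of_dist_le_of_summable _ (fun n => ?_) hsum
    rw [dist_comm, dist_eq_norm]
    exact sqrtIter_diff_le hX n
  obtain ⟨Y, hY⟩ := cauchySeq_tendsto_of_complete hc
  refine ⟨Y, hY, ?_, ?_⟩
  · exact le_of_tendsto hY.norm
      (Eventually.of_forall fun n => (sqrtIter_norm_le hX n).trans (sqrtIter_real_bounds n).2)
  · have h1 : Tendsto (fun n => sqrtIter X (n + 1)) atTop (𝓝 Y) :=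
      hY.comp (tendsto_add_atTop_nat 1)
    have h2 : Tendsto (fun n => sqrtIter X (n + 1)) atTop (𝓝 ((2⁻¹ : ℝ) • (X + Y * Y))) :=
      ((hY.mul hY).const_add X).const_smul (2⁻¹ : ℝ)
    have h3 := tendsto_nhds_unique h1 h2
    have h4 : Y + Y = X + Y * Y := by
      conv_lhs => rw [h3]
      rw [← add_smul]
      norm_num
    have h5 : (1 - Y) * (1 - Y) = 1 - (Y + Y) + Y * Y := by noncomm_ring
    rw [h5, h4]
    abel

/-- A bounded positive operator on a real Hilbert space has a bounded positive square root. -/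
theorem exists_bounded_sqrt (T : H →L[ℝ] H) (hsym : ∀ x y, ⟪T x, y⟫ = ⟪x, T y⟫)
    (hpos : ∀ x, 0 ≤ ⟪T x, x⟫) :
    ∃ R : H →L[ℝ] H, (∀ x y, ⟪R x, y⟫ = ⟪x, R y⟫) ∧ (∀ x, 0 ≤ ⟪R x, x⟫) ∧ ∀ x, R (R x) = T x := by
  obtain ⟨k, hk, hTk⟩ : ∃ k : ℝ, 0 < k ∧ ‖T‖ ≤ k := ⟨‖T‖ + 1, by positivity, by linarith⟩
  set X : H →L[ℝ] H := 1 - k⁻¹ • T with hXdef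
  have hXa : ∀ x, X x = x - k⁻¹ • T x := fun x => by simp [hXdef]
  have hXsym : ∀ x y, ⟪X x, y⟫ = ⟪x, X y⟫ := fun x y => by
    simp only [hXa, inner_sub_left, inner_sub_right, inner_smul_left, inner_smul_right, hsym]
    simp
  have hXnorm : ‖X‖ ≤ 1 := by
    rw [X.norm_eq_iSup_rayleighQuotient (fun x y => hXsym x y)]
    refine ciSup_le fun x => ?_
    have h1 : X.reApplyInnerSelf x = ‖x‖ ^ 2 - k⁻¹ * ⟪T x, x⟫ := by
      rw [ContinuousLinearMap.reApplyInnerSelf_apply, hXa, inner_sub_left, inner_smul_left,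
        real_inner_self_eq_norm_sq]
      simp
    have h2 : ⟪T x, x⟫ ≤ k * ‖x‖ ^ 2 := by
      have := real_inner_le_norm (T x) x
      have h3 := T.le_of_opNorm_le hTk x
      nlinarith [norm_nonneg x]
    have h3 : k⁻¹ * ⟪T x, x⟫ ≤ ‖x‖ ^ 2 := by
      rw [inv_mul_le_iff₀ hk]; exact h2
    have h4 : 0 ≤ k⁻¹ * ⟪T x, x⟫ := mul_nonneg (by positivity) (hpos x)
    rw [ContinuousLinearMap.rayleighQuotient, h1, abs_div, abs_of_nonneg (by linarith),
      abs_of_nonneg (by positivity)]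
    exact div_le_one_of_le₀ (by linarith) (by positivity)
  obtain ⟨Y, hY, hYn, hYX⟩ := sqrtIter_tendsto hXnorm
  have hitsym : ∀ n, ∀ x y, ⟪sqrtIter X n x, y⟫ = ⟪x, sqrtIter X n y⟫ := fun n => by
    induction n with
    | zero => intro x y; simp [sqrtIter]
    | succ n ih =>
      intro x y
      simp [sqrtIter, inner_add_left, inner_add_right, inner_smul_left, inner_smul_right, ih, hXsym]
  have hYap : ∀ x, Tendsto (fun n => sqrtIter X n x) atTop (𝓝 (Y x)) := fun x =>
    ((ContinuousLinearMap.apply ℝ H x).continuous.tendsto Y).comp hY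
  have hYsym : ∀ x y, ⟪Y x, y⟫ = ⟪x, Y y⟫ := fun x y =>
    tendsto_nhds_unique (((hYap x).inner tendsto_const_nhds).congr fun n => hitsym n x y)
      (tendsto_const_nhds.inner (hYap y))
  have hRR : ∀ x, (1 - Y) ((1 - Y) x) = k⁻¹ • T x := fun x => by
    have := DFunLike.congr_fun hYX x
    rw [mul_apply_eq_comp] at this
    rw [this, sub_apply, hXa]
    simp
  refine ⟨√k • (1 - Y), fun x y => ?_, fun x => ?_, fun x => ?_⟩
  · simp [inner_sub_left, inner_sub_right, inner_smul_left, inner_smul_right, hYsym]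
  · simp only [smul_apply, inner_smul_left, sub_apply,
      one_apply_eq_self, inner_sub_left, real_inner_self_eq_norm_sq]
    refine mul_nonneg (Real.sqrt_nonneg _) ?_
    have := real_inner_le_norm (Y x) x
    have h3 := Y.le_of_opNorm_le hYn x
    nlinarith [norm_nonneg x]
  · rw [smul_apply, smul_apply, map_smul, hRR, smul_smul,
      smul_smul, Real.mul_self_sqrt hk.le, mul_inv_cancel₀ hk.ne', one_smul]

/-- A coercive self-adjoint operator has a bounded positive inverse. -/
theorem exists_bounded_inverse {B : H →ₗ.[ℝ] H} (hB : IsSelfAdjoint B) (hc : IsCoerciveOp B) :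
    ∃ T : H →L[ℝ] H, (∀ x y, ⟪T x, y⟫ = ⟪x, T y⟫) ∧ (∀ x, 0 ≤ ⟪T x, x⟫) ∧
      ∀ x y, (x, y) ∈ B.graph ↔ T y = x := by
  obtain ⟨b, hb, hcoer⟩ := hc
  have hadj : B.graph = B.graph.adjoint := by
    rw [← LinearPMap.adjoint_graph_eq_graph_adjoint hB.dense_domain,
      LinearPMap.isSelfAdjoint_def.1 hB]
  have hco : ∀ x y, (x, y) ∈ B.graph → b * ‖x‖ ^ 2 ≤ ⟪y, x⟫ := by
    intro x y h
    obtain ⟨v, h1, h2⟩ := (LinearPMap.mem_graph_iff _).1 h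
    have := hcoer v
    simp only at h1 h2
    rwa [h2, h1] at this
  have hbd : ∀ x y, (x, y) ∈ B.graph → ‖x‖ ≤ b⁻¹ * ‖y‖ := by
    intro x y h
    have h1 := hco x y h
    have h2 := real_inner_le_norm y x
    rw [le_inv_mul_iff₀ hb]
    rcases (norm_nonneg x).eq_or_lt with h0 | h0
    · rw [← h0]; simp
    · exact le_of_mul_le_mul_right (by nlinarith) h0
  have hsymm : ∀ x y x' y', (x, y) ∈ B.graph → (x', y') ∈ B.graph → ⟪y, x'⟫ = ⟪x, y'⟫ := by
    intro x y x' y' h h'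
    rw [hadj, Submodule.mem_adjoint_iff] at h'
    exact sub_eq_zero.1 (h' x y h)
  have hsurj : ∀ y, ∃ x, (x, y) ∈ B.graph := by
    let f : B.graph →L[ℝ] H := (ContinuousLinearMap.snd ℝ H H).comp B.graph.subtypeL
    have hgc : IsClosed (B.graph : Set (H × H)) := hB.isClosed
    have : CompleteSpace B.graph := hgc.completeSpace_coe
    have hanti : AntilipschitzWith (Real.toNNReal (b⁻¹ + 1)) f := by
      refine f.antilipschitz_of_bound fun p => ?_
      have hp := hbd p.1.1 p.1.2 p.2
      rw [Real.coe_toNNReal _ (by positivity)]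
      change max ‖p.1.1‖ ‖p.1.2‖ ≤ (b⁻¹ + 1) * ‖p.1.2‖
      have h0 : 0 ≤ b⁻¹ * ‖p.1.2‖ := by positivity
      refine max_le ?_ ?_ <;> nlinarith [norm_nonneg p.1.2]
    have hcl : IsClosed (LinearMap.range f.toLinearMap : Set H) := by
      have h := hanti.isClosed_range f.uniformContinuous
      have e : (LinearMap.range f.toLinearMap : Set H) = Set.range f := Set.ext fun _ => Iff.rfl
      rw [e]
      exact h
    have : CompleteSpace (LinearMap.range f.toLinearMap) := hcl.completeSpace_coe
    have htop : LinearMap.range f.toLinearMap = ⊤ := by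
      rw [← Submodule.orthogonal_eq_bot_iff, Submodule.eq_bot_iff]
      intro w hw
      have hw0 : (w, (0 : H)) ∈ B.graph := by
        rw [hadj, Submodule.mem_adjoint_iff]
        intro x y hxy
        have := (Submodule.mem_orthogonal _ _).1 hw y ⟨⟨(x, y), hxy⟩, rfl⟩
        simp [this]
      have := hbd _ _ hw0
      simpa using this
    intro y
    obtain ⟨p, hp⟩ : y ∈ LinearMap.range f.toLinearMap := htop ▸ Submodule.mem_top
    refine ⟨p.1.1, ?_⟩
    have : p.1.2 = y := hp
    rw [← this]
    exact p.2
  have huniq : ∀ x x' y, (x, y) ∈ B.graph → (x', y) ∈ B.graph → x = x' := by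
    intro x x' y h h'
    have := hbd _ _ (B.graph.sub_mem h h')
    simpa [sub_eq_zero] using this
  choose t ht using hsurj
  let T₀ : H →ₗ[ℝ] H :=
    { toFun := t
      map_add' := fun x y => huniq _ _ _ (ht _) (B.graph.add_mem (ht x) (ht y))
      map_smul' := fun a x => huniq _ _ _ (ht _) (B.graph.smul_mem a (ht x)) }
  let T : H →L[ℝ] H := T₀.mkContinuous b⁻¹ fun y => hbd _ _ (ht y)
  have hT : ∀ y, T y = t y := fun y => rfl
  refine ⟨T, fun x y => ?_, fun x => ?_, fun x y => ⟨fun h => ?_, fun h => ?_⟩⟩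
  · rw [hT, hT]
    exact (hsymm _ _ _ _ (ht x) (ht y)).symm
  · rw [hT, real_inner_comm]
    exact le_trans (by positivity) (hco _ _ (ht x))
  · exact huniq _ _ _ (ht y) h
  · rw [← h]; exact ht y

/-- A coercive self-adjoint operator has a positive square root. -/
theorem exists_isPosSqrt {B : H →ₗ.[ℝ] H} (hB : IsSelfAdjoint B) (hc : IsCoerciveOp B) :
    ∃ S : H →ₗ.[ℝ] H, IsPosSqrt S B := by
  obtain ⟨T, hTs, hTp, hTB⟩ := exists_bounded_inverse hB hc
  obtain ⟨R, hRs, hRp, hRR⟩ := exists_bounded_sqrt T hTs hTp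
  have hTinj : ∀ y, T y = 0 → y = 0 := fun y hy =>
    LinearPMap.graph_fst_eq_zero_snd B ((hTB 0 y).2 hy) rfl
  have hRinj : ∀ y, R y = 0 → y = 0 := fun y hy => hTinj y (by rw [← hRR, hy, map_zero])
  let P : H →ₗ.[ℝ] H := R.toLinearMap.toPMap ⊤
  have hP : ∀ x y : H, (x, y) ∈ P.graph ↔ R x = y := by
    intro x y
    rw [LinearPMap.mem_graph_iff]
    constructor
    · rintro ⟨v, h1, h2⟩
      simp only at h1 h2
      rw [← h1, ← h2]; rfl
    · intro h
      exact ⟨⟨x, Submodule.mem_top⟩, rfl, h⟩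
  have hker : LinearMap.ker P.toFun = ⊥ := by
    rw [LinearMap.ker_eq_bot']
    intro m hm
    exact Subtype.ext (hRinj m hm)
  let S := P.inverse
  have hS : ∀ x y : H, (x, y) ∈ S.graph ↔ R y = x := by
    intro x y
    rw [← hP]
    change (x, y) ∈ P.inverse.graph ↔ _
    rw [LinearPMap.inverse_graph hker]
    simp
  have hdense : Dense (S.domain : Set H) := by
    rw [Submodule.dense_iff_topologicalClosure_eq_top,
      Submodule.topologicalClosure_eq_top_iff, Submodule.eq_bot_iff]
    intro w hw
    refine hRinj w (ext_inner_left ℝ fun v => ?_)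
    have hmem : R v ∈ S.domain := LinearPMap.mem_domain_of_mem_graph ((hS _ _).2 rfl)
    rw [← hRs, inner_zero_right]
    exact (Submodule.mem_orthogonal _ _).1 hw _ hmem
  refine ⟨S, ?_, ?_, ?_⟩
  · rw [LinearPMap.isSelfAdjoint_def]
    refine LinearPMap.eq_of_eq_graph ?_
    rw [LinearPMap.adjoint_graph_eq_graph_adjoint hdense]
    ext ⟨x, y⟩
    rw [Submodule.mem_adjoint_iff, hS]
    constructor
    · intro h
      refine ext_inner_left ℝ fun v => ?_
      have := h (R v) v ((hS _ _).2 rfl)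
      rw [← hRs]
      exact (sub_eq_zero.1 this).symm
    · rintro rfl a v h
      rw [hS] at h
      rw [← h, hRs, sub_self]
  · intro x
    have h := (hS _ _).1 (S.mem_graph x)
    have h2 := hRp (S x)
    rwa [h, real_inner_comm] at h2
  · intro x z
    rw [hTB]
    simp only [hS]
    constructor
    · intro h
      exact ⟨R z, by rw [hRR, h], rfl⟩
    · rintro ⟨y, h1, h2⟩
      rw [← hRR, h2, h1]

open Classical in
/-- The square root `B^{1/2}` of a coercive self-adjoint operator `B`: the positive self-adjoint
operator whose square is `B` (it is classically unique; it exists by `exists_isPosSqrt`). The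
zero operator with zero domain if there is none. -/
noncomputable def sqrtOp (B : H →ₗ.[ℝ] H) : H →ₗ.[ℝ] H :=
  if h : ∃ S : H →ₗ.[ℝ] H, IsPosSqrt S B then h.choose else ⊥

theorem sqrtOp_spec {B : H →ₗ.[ℝ] H} (hB : IsSelfAdjoint B) (hc : IsCoerciveOp B) :
    IsPosSqrt (sqrtOp B) B := by
  have h := exists_isPosSqrt hB hc
  rw [sqrtOp, dif_pos h]
  exact h.choose_spec

end SquareRoot

section Evolution

variable {H : Type*} [NormedAddCommGroup H] [InnerProductSpace ℝ H] [CompleteSpace H]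

/-- The space `V = D(B^{1/2})`. -/
noncomputable abbrev formDomain (B : H →ₗ.[ℝ] H) : Submodule ℝ H := (sqrtOp B).domain

/-- The norm `‖v‖ = |B^{1/2} v|` of `V`. -/
noncomputable def normV (B : H →ₗ.[ℝ] H) (v : formDomain B) : ℝ := ‖sqrtOp B v‖

/-- The duality pairing `⟨B v, w⟩` between `V'` and `V`, where `B` also denotes the extension
`V → V'` of the operator, namely `⟨B v, w⟩ = ⟨B^{1/2} v, B^{1/2} w⟩` for `v, w ∈ V`. -/
noncomputable def pairing (B : H →ₗ.[ℝ] H) (v w : formDomain B) : ℝ :=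
  ⟪sqrtOp B v, sqrtOp B w⟫

/-- The pairing extends the inner product `⟨B v, w⟩` of `H`, defined for `v ∈ D(B)`. -/
theorem pairing_eq_inner {B : H →ₗ.[ℝ] H} (hB : IsSelfAdjoint B) (hc : IsCoerciveOp B)
    (v : B.domain) :
    ∃ hv : (v : H) ∈ formDomain B, ∀ w : formDomain B, pairing B ⟨v, hv⟩ w = ⟪B v, (w : H)⟫ := by
  have hS := sqrtOp_spec hB hc
  obtain ⟨y, h1, h2⟩ := (hS.comp_self _ _).1 (B.mem_graph v)
  refine ⟨LinearPMap.mem_domain_of_mem_graph h1, fun w => ?_⟩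
  obtain ⟨v', e1, e2⟩ := (LinearPMap.mem_graph_iff _).1 h1
  obtain ⟨y', e3, e4⟩ := (LinearPMap.mem_graph_iff _).1 h2
  simp only at e1 e2 e3 e4
  have hf : (sqrtOp B).IsFormalAdjoint (sqrtOp B) := by
    have := LinearPMap.adjoint_isFormalAdjoint hS.selfAdjoint.dense_domain
    rwa [LinearPMap.isSelfAdjoint_def.1 hS.selfAdjoint] at this
  have hv : (⟨v, LinearPMap.mem_domain_of_mem_graph h1⟩ : formDomain B) = v' := Subtype.ext e1.symm
  rw [pairing, hv, e2, ← e3, ← hf y' w, e4]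

/-- `γ ∈ L(H)` belongs to `L(V)`: it maps `V` into `V`, boundedly for the norm of `V`. -/
def IsBoundedOnV (B : H →ₗ.[ℝ] H) (γ : H →L[ℝ] H) : Prop :=
  ∃ K : ℝ, ∀ v : formDomain B, ∃ hv : γ v ∈ formDomain B, normV B ⟨γ v, hv⟩ ≤ K * normV B v

/-- The number `‖A‖ = ess sup_{t ≥ 0} ‖A(t)‖_{L(H)}`. -/
noncomputable def essSupNorm (A : ℝ → H →L[ℝ] H) : ℝ :=
  (eLpNorm A ⊤ (volume.restrict (Ici (0 : ℝ)))).toReal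

/-- `u` is a mild solution on `[0, ∞)` of `u'' + (B + A(t)) u + γ u' = 0`, with derivative `u'`:
`u ∈ C([0, ∞), V) ∩ C¹([0, ∞), H)` and the equation holds in `V'` in integrated form,
`u'(t) = u'(0) - ∫₀ᵗ (B u + A u + γ u') dτ`, both sides being tested with the elements of `V`.
(The integrand is locally essentially bounded with values in `V'`, so that this says that
`u ∈ W^{2,∞}_loc([0, ∞), V')` with `u'' = - (B + A(t)) u - γ u'` in `V'` almost everywhere.)
The values of `u` and `u'` at negative times are irrelevant. -/
structure IsMildSolution (B : H →ₗ.[ℝ] H) (A : ℝ → H →L[ℝ] H) (γ : H →L[ℝ] H)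
    (u : ℝ → formDomain B) (u' : ℝ → H) : Prop where
  continuousOn_V : ContinuousOn (fun t => sqrtOp B (u t)) (Ici 0)
  hasDeriv : ∀ t : ℝ, 0 ≤ t → HasDerivWithinAt (fun τ => (u τ : H)) (u' t) (Ici 0) t
  continuousOn_deriv : ContinuousOn u' (Ici 0)
  equation : ∀ v : formDomain B, ∀ t : ℝ, 0 ≤ t →
    ⟪u' t, (v : H)⟫ = ⟪u' 0, (v : H)⟫ -
      ∫ τ in (0 : ℝ)..t,
        (pairing B (u τ) v + ⟪A τ (u τ : H), (v : H)⟫ + ⟪γ (u' τ), (v : H)⟫)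

end Evolution

end HilbertEvolution

/-! Put `S = B^{1/2}`, `R = S⁻¹` and `y = S u`, so that `‖u‖ = |y|` and the equation becomes a system
in `H` for the pair `(y, u')`. The decay comes from the Lyapunov functional
`E = ‖u‖² + |u'|² / 2 + |u' + γ u|² / 2` (`energy`), which is equivalent to `‖u‖² + |u'|²`
(`le_energy`, `energy_le`). Formally, testing the equation with `u'` and, in the form
`(u' + γ u)' = -(B + A) u`, with `u' + γ u`, one finds
`E' = -⟨γ u', u'⟩ - ⟨B u, γ u⟩ - ⟨A u, 2 u' + γ u⟩`
`  ≤ -c |u'|² - ρ |u|² - η ‖u‖² + ‖A‖ |u| (2 |u'| + Γ |u|)`.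
The quadratic form in `(|u'|, |u|)` is negative definite exactly when `‖A‖² + c Γ ‖A‖ < c ρ`, which
is the smallness assumption on `A` (`exists_velocity_margin`). Hence `E' ≤ -δ E`.

A mild solution is not regular enough for this computation, since `u'` need not take values in `V`.
It is carried out for the time averages `h⁻¹ ∫_t^{t+h}` of `y` and `u'`, which are continuously
differentiable in `H` and commute with `γ` and `R` (`hasDerivAt_energy_forwardAvg`). The only term
that is not closed under averaging is `A u`; its average is bounded by `‖A‖` times the norm of the
average of `u` up to `O(h)` (`norm_forwardAvg_forcing_le`). A Grönwall estimate and the limit `h → 0`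
give the decay of `E` (`energy_le_exp_mul`). -/

namespace HilbertEvolution

/-! ### Forward time averages -/

section Average

variable {E F : Type*} [NormedAddCommGroup E] [NormedSpace ℝ E]
  [NormedAddCommGroup F] [NormedSpace ℝ F]

/-- The forward (Steklov) time average `h⁻¹ ∫_t^{t+h} f`. -/
noncomputable def forwardAvg (h : ℝ) (f : ℝ → E) (t : ℝ) : E := h⁻¹ • ∫ τ in t..t + h, f τ

theorem hasDerivAt_forwardAvg [CompleteSpace E] {f : ℝ → E} (hf : Continuous f) (h t : ℝ) :
    HasDerivAt (forwardAvg h f) (h⁻¹ • (f (t + h) - f t)) t := by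
  have h1 : ∀ x, HasDerivAt (fun x => ∫ τ in (0 : ℝ)..x, f τ) (f x) x := fun x =>
    intervalIntegral.integral_hasDerivAt_right (hf.intervalIntegrable _ _)
      (hf.stronglyMeasurableAtFilter _ _) hf.continuousAt
  have h2 := (((h1 (t + h)).comp_add_const t h).sub (h1 t)).const_smul h⁻¹
  refine h2.congr_of_eventuallyEq (Eventually.of_forall fun x => ?_)
  simp only [forwardAvg, Pi.smul_apply, Pi.sub_apply]
  rw [intervalIntegral.integral_interval_sub_left (hf.intervalIntegrable _ _)
    (hf.intervalIntegrable _ _)]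

theorem tendsto_forwardAvg [CompleteSpace E] {f : ℝ → E} (hf : Continuous f) (t : ℝ) :
    Tendsto (fun h => forwardAvg h f t) (𝓝[>] 0) (𝓝 (f t)) := by
  have h1 : HasDerivAt (fun x => ∫ τ in t..x, f τ) (f t) t :=
    intervalIntegral.integral_hasDerivAt_right (hf.intervalIntegrable _ _)
      (hf.stronglyMeasurableAtFilter _ _) hf.continuousAt
  simpa [forwardAvg] using h1.tendsto_slope_zero_right

theorem norm_forwardAvg_le {f : ℝ → E} {h t C : ℝ} (hh : 0 < h)
    (hC : ∀ᵐ τ, τ ∈ Ioc t (t + h) → ‖f τ‖ ≤ C) : ‖forwardAvg h f t‖ ≤ C := by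
  have h1 : ‖∫ τ in t..t + h, f τ‖ ≤ C * |t + h - t| := by
    refine intervalIntegral.norm_integral_le_of_norm_le_const_ae ?_
    rwa [uIoc_of_le (by linarith)]
  rw [add_sub_cancel_left, abs_of_pos hh] at h1
  rw [forwardAvg, norm_smul, norm_inv, Real.norm_of_nonneg hh.le, inv_mul_le_iff₀ hh]
  linarith

theorem map_forwardAvg [CompleteSpace E] [CompleteSpace F] (L : E →L[ℝ] F) {f : ℝ → E} {h t : ℝ}
    (hf : IntervalIntegrable f volume t (t + h)) :
    L (forwardAvg h f t) = forwardAvg h (fun τ => L (f τ)) t := by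
  rw [forwardAvg, forwardAvg, map_smul, L.intervalIntegral_comp_comm hf]

end Average

/-! ### The Lyapunov functional and its decay -/

section Energy

variable {H : Type*} [NormedAddCommGroup H] [InnerProductSpace ℝ H]

/-- The equation in the coordinates `y = B^{1/2} u`, `v = u'`, with `R = B^{-1/2}` (so `u = R y`)
and forcing term `g = A u`: `u' = v` and `v' = -(B u + g + γ v)`, both integrated in time, the
second one after application of `R`, which turns it from an identity in `V'` into one in `H`. -/
structure IsIntegratedSolution (R γ : H →L[ℝ] H) (y v g : ℝ → H) : Prop where
  continuous_y : Continuous y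
  continuous_v : Continuous v
  integrable_g : ∀ s t, 0 ≤ s → s ≤ t → IntervalIntegrable g volume s t
  position : ∀ s t, 0 ≤ s → s ≤ t → R (y t) - R (y s) = ∫ τ in s..t, v τ
  velocity : ∀ s t, 0 ≤ s → s ≤ t → R (v t - v s) =
    -((∫ τ in s..t, y τ) + R ((∫ τ in s..t, g τ) + γ (∫ τ in s..t, v τ)))

/-- The Lyapunov functional `‖u‖² + |u'|²/2 + |u' + γ u|²/2` in the coordinates `y = B^{1/2} u`,
`v = u'`. -/
noncomputable def energy (R γ : H →L[ℝ] H) (y v : H) : ℝ :=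
  ‖y‖ ^ 2 + 2⁻¹ * ‖v‖ ^ 2 + 2⁻¹ * ‖v + γ (R y)‖ ^ 2

theorem le_energy (R γ : H →L[ℝ] H) (y v : H) : ‖y‖ ^ 2 + ‖v‖ ^ 2 ≤ 2 * energy R γ y v := by
  have := sq_nonneg ‖v + γ (R y)‖
  have := sq_nonneg ‖y‖
  simp only [energy]
  linarith

theorem energy_le (R γ : H →L[ℝ] H) (y v : H) :
    energy R γ y v ≤ (3 / 2 + ‖γ‖ ^ 2 * ‖R‖ ^ 2) * (‖y‖ ^ 2 + ‖v‖ ^ 2) := by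
  have h1 : ‖γ (R y)‖ ≤ ‖γ‖ * ‖R‖ * ‖y‖ := by
    refine (γ.le_opNorm _).trans ?_
    rw [mul_assoc]
    gcongr
    exact R.le_opNorm y
  have h2 : ‖γ (R y)‖ ^ 2 ≤ ‖γ‖ ^ 2 * ‖R‖ ^ 2 * ‖y‖ ^ 2 := by
    rw [← mul_pow, ← mul_pow]
    gcongr
  have h3 : ‖v + γ (R y)‖ ^ 2 ≤ (‖v‖ + ‖γ (R y)‖) ^ 2 := by
    gcongr
    exact norm_add_le _ _
  have h4 : 0 ≤ ‖γ‖ ^ 2 * ‖R‖ ^ 2 * ‖v‖ ^ 2 := by positivity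
  simp only [energy]
  nlinarith [sq_nonneg (‖v‖ - ‖γ (R y)‖), sq_nonneg ‖y‖]

theorem tendsto_energy_forwardAvg [CompleteSpace H] (R γ : H →L[ℝ] H) {y v : ℝ → H}
    (hy : Continuous y) (hv : Continuous v) (t : ℝ) :
    Tendsto (fun h => energy R γ (forwardAvg h y t) (forwardAvg h v t)) (𝓝[>] 0)
      (𝓝 (energy R γ (y t) (v t))) := by
  have h1 := tendsto_forwardAvg hy t
  have h2 := tendsto_forwardAvg hv t
  have h3 := (γ.continuous.tendsto _).comp ((R.continuous.tendsto _).comp h1)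
  exact ((h1.norm.pow 2).add ((h2.norm.pow 2).const_mul _)).add
    (((h2.add h3).norm.pow 2).const_mul _)

/-- The energy identity for time averages. Averaging makes `v` differentiable in `H` and puts it
into `V`, and it commutes with `γ`, so that the multipliers `u'` and `u' + γ u` are admissible. -/
theorem hasDerivAt_energy_forwardAvg [CompleteSpace H] {R γ : H →L[ℝ] H}
    (hR : ∀ x z, ⟪R x, z⟫ = ⟪x, R z⟫)
    {y v g : ℝ → H} (hs : IsIntegratedSolution R γ y v g) {h t : ℝ} (hh : 0 < h) (ht : 0 ≤ t)
    {z : H} (hz : R z = γ (R (forwardAvg h y t))) :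
    HasDerivAt (fun t => energy R γ (forwardAvg h y t) (forwardAvg h v t))
      (-(⟪γ (forwardAvg h v t), forwardAvg h v t⟫ + ⟪forwardAvg h y t, z⟫ +
        ⟪forwardAvg h g t, (2 : ℝ) • forwardAvg h v t + γ (R (forwardAvg h y t))⟫)) t := by
  have hdy := hasDerivAt_forwardAvg hs.continuous_y h t
  have hdv := hasDerivAt_forwardAvg hs.continuous_v h t
  have hdw := hdv.add (γ.hasFDerivAt.comp_hasDerivAt t (R.hasFDerivAt.comp_hasDerivAt t hdy))
  have hE := (hdy.norm_sq.add (hdv.norm_sq.const_mul 2⁻¹)).add (hdw.norm_sq.const_mul 2⁻¹)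
  refine hE.congr_deriv ?_
  have hRd : R (h⁻¹ • (y (t + h) - y t)) = forwardAvg h v t := by
    rw [map_smul, map_sub, hs.position t (t + h) ht (by linarith), forwardAvg]
  have hRe : R (h⁻¹ • (v (t + h) - v t)) =
      -(forwardAvg h y t + R (forwardAvg h g t + γ (forwardAvg h v t))) := by
    rw [map_smul, hs.velocity t (t + h) ht (by linarith)]
    simp only [forwardAvg, map_smul, smul_neg, smul_add, map_add]
  simp only [Pi.add_apply, Function.comp_apply]
  generalize h⁻¹ • (y (t + h) - y t) = d at *
  generalize h⁻¹ • (v (t + h) - v t) = e at *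
  generalize forwardAvg h y t = Y at *
  generalize forwardAvg h v t = V at *
  generalize forwardAvg h g t = G at *
  rw [hRd, ← hz]
  have e1 : ∀ x, ⟪R x, e⟫ = -(⟪x, Y⟫ + ⟪R x, G⟫ + ⟪R x, γ V⟫) := fun x => by
    rw [hR, hRe, inner_neg_right, inner_add_right, ← hR, inner_add_right]
    ring
  have e2 : ⟪V, e⟫ = -(⟪d, Y⟫ + ⟪V, G⟫ + ⟪V, γ V⟫) := by simpa only [hRd] using e1 d
  have e3 := e1 z
  simp only [inner_add_left, inner_add_right, inner_smul_right, e2, e3]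
  rw [real_inner_comm d Y, real_inner_comm G V, real_inner_comm (γ V) V, real_inner_comm z Y,
    real_inner_comm G (R z)]
  ring

/-- The discriminant condition behind the smallness of `A`: it leaves a positive multiple of the
velocity term. -/
theorem exists_velocity_margin {a c ρ Γ : ℝ} (hc : 0 < c) (ha : 0 ≤ a) (hΓ : 0 ≤ Γ)
    (h : a < √(c * ρ + c ^ 2 / 4 * Γ ^ 2) - c / 2 * Γ) :
    ∃ κ : ℝ, 0 < κ ∧ ∀ p q : ℝ,
      κ * p ^ 2 ≤ c * p ^ 2 + ρ * q ^ 2 - a * q * (2 * p + Γ * q) := by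
  have h1 : (a + c / 2 * Γ) ^ 2 < c * ρ + c ^ 2 / 4 * Γ ^ 2 :=
    (Real.lt_sqrt (by positivity)).1 (by linarith)
  have h2 : a ^ 2 < c * (ρ - a * Γ) := by nlinarith
  have hm : 0 < ρ - a * Γ := pos_of_mul_pos_right ((sq_nonneg a).trans_lt h2) hc.le
  refine ⟨c - a ^ 2 / (ρ - a * Γ), sub_pos.2 ((div_lt_iff₀ hm).2 h2), fun p q => ?_⟩
  have h3 : c * p ^ 2 + ρ * q ^ 2 - a * q * (2 * p + Γ * q) - (c - a ^ 2 / (ρ - a * Γ)) * p ^ 2 =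
      (a * p - (ρ - a * Γ) * q) ^ 2 / (ρ - a * Γ) := by
    field_simp
    ring
  have h4 : 0 ≤ (a * p - (ρ - a * Γ) * q) ^ 2 / (ρ - a * Γ) := by positivity
  linarith

/-- The average of a forcing term dominated by `|R y|` is dominated by the average of `R y` up to
an error of the order of `h`, because `R y` has the bounded derivative `v`. -/
theorem norm_forwardAvg_forcing_le [CompleteSpace H] {R γ : H →L[ℝ] H} {y v g : ℝ → H}
    (hs : IsIntegratedSolution R γ y v g) {a : ℝ} (ha : 0 ≤ a)
    (hg : ∀ᵐ τ, 0 ≤ τ → ‖g τ‖ ≤ a * ‖R (y τ)‖) {h t L : ℝ} (hh : 0 < h) (ht : 0 ≤ t)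
    (hL : ∀ τ ∈ Icc t (t + h), ‖v τ‖ ≤ L) :
    ‖forwardAvg h g t‖ ≤ a * ‖R (forwardAvg h y t)‖ + 2 * a * L * h := by
  have hL0 : 0 ≤ L := (norm_nonneg _).trans (hL t ⟨le_rfl, by linarith⟩)
  have hu : ∀ τ ∈ Ioc t (t + h), ‖R (y τ) - R (y t)‖ ≤ L * h := by
    intro τ hτ
    rw [hs.position t τ ht hτ.1.le]
    have h1 : ‖∫ r in t..τ, v r‖ ≤ L * |τ - t| := by
      refine intervalIntegral.norm_integral_le_of_norm_le_const fun r hr => hL r ?_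
      rw [uIoc_of_le hτ.1.le] at hr
      exact ⟨hr.1.le, hr.2.trans hτ.2⟩
    rw [abs_of_pos (sub_pos.2 hτ.1)] at h1
    exact h1.trans (mul_le_mul_of_nonneg_left (by linarith [hτ.2]) hL0)
  have hav : ‖R (forwardAvg h y t) - R (y t)‖ ≤ L * h := by
    have hRy : IntervalIntegrable (fun τ => R (y τ)) volume t (t + h) :=
      (R.continuous.comp hs.continuous_y).intervalIntegrable _ _
    have e : R (forwardAvg h y t) - R (y t) = forwardAvg h (fun τ => R (y τ) - R (y t)) t := by
      rw [map_forwardAvg R (hs.continuous_y.intervalIntegrable _ _), forwardAvg, forwardAvg,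
        intervalIntegral.integral_sub hRy intervalIntegrable_const, smul_sub,
        intervalIntegral.integral_const, add_sub_cancel_left, inv_smul_smul₀ hh.ne']
    rw [e]
    exact norm_forwardAvg_le hh (Eventually.of_forall hu)
  refine norm_forwardAvg_le hh ?_
  filter_upwards [hg] with τ hgτ hτ
  refine (hgτ (ht.trans hτ.1.le)).trans ?_
  have h1 : ‖R (y τ)‖ ≤ ‖R (forwardAvg h y t)‖ + 2 * (L * h) := by
    have h2 := norm_sub_le (R (y τ) - R (y t)) (R (forwardAvg h y t) - R (y t))
    rw [sub_sub_sub_cancel_right] at h2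
    have h3 := norm_le_norm_add_norm_sub (R (forwardAvg h y t)) (R (y τ))
    rw [norm_sub_rev] at h3
    linarith [hu τ hτ]
  nlinarith

/-- A Grönwall estimate with an additive error. -/
theorem le_exp_mul_add_of_deriv_le {f f' : ℝ → ℝ} {δ ε s t : ℝ} (hδ : 0 ≤ δ) (hε : 0 ≤ ε)
    (hst : s ≤ t)
    (hf : ∀ r ∈ Icc s t, HasDerivAt f (f' r) r) (hle : ∀ r ∈ Icc s t, f' r ≤ -δ * f r + ε) :
    f t ≤ f s * Real.exp (-δ * (t - s)) + ε * (t - s) := by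
  have hd : ∀ r ∈ Icc s t, HasDerivAt (fun r => f r * Real.exp (δ * (r - t)) - ε * r)
      (f' r * Real.exp (δ * (r - t)) + f r * (Real.exp (δ * (r - t)) * (δ * 1)) - ε * 1) r :=
    fun r hr => ((hf r hr).mul ((((hasDerivAt_id r).sub_const t).const_mul δ).exp)).sub
      ((hasDerivAt_id r).const_mul ε)
  have hanti : AntitoneOn (fun r => f r * Real.exp (δ * (r - t)) - ε * r) (Icc s t) := by
    refine antitoneOn_of_deriv_nonpos (convex_Icc s t)
      (fun r hr => (hd r hr).continuousAt.continuousWithinAt)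
      (fun r hr => (hd r (interior_subset hr)).differentiableAt.differentiableWithinAt)
      fun r hr => ?_
    have hr' := interior_subset hr
    rw [(hd r hr').deriv]
    have h1 := hle r hr'
    have h2 : Real.exp (δ * (r - t)) ≤ 1 :=
      Real.exp_le_one_iff.2 (mul_nonpos_of_nonneg_of_nonpos hδ (by linarith [hr'.2]))
    have h3 := Real.exp_pos (δ * (r - t))
    nlinarith
  have := hanti (left_mem_Icc.2 hst) (right_mem_Icc.2 hst) hst
  simp only [sub_self, mul_zero, Real.exp_zero, mul_one] at this
  rw [show -δ * (t - s) = δ * (s - t) by ring]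
  linarith

/-- Exponential decay of the Lyapunov functional. The hypothesis `hγV` says that `γ` maps `V` into
`V` with `⟨B u, γ u⟩ ≥ ρ |u|² + η ‖u‖²`, for `u = R x` and `γ u = R z`. The rate is the constant of
the dissipation estimate divided by the constant of `energy_le`. -/
theorem energy_le_exp_mul [CompleteSpace H] {R γ : H →L[ℝ] H} (hR : ∀ x z, ⟪R x, z⟫ = ⟪x, R z⟫)
    {y v g : ℝ → H} (hs : IsIntegratedSolution R γ y v g) {a c ρ η κ : ℝ} (ha : 0 ≤ a)
    (hκ : 0 < κ) (hη : 0 < η) (hg : ∀ᵐ τ, 0 ≤ τ → ‖g τ‖ ≤ a * ‖R (y τ)‖)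
    (hγ : ∀ x, c * ‖R x‖ ^ 2 ≤ ⟪γ (R x), R x⟫)
    (hγV : ∀ x, ∃ z, R z = γ (R x) ∧ ρ * ‖R x‖ ^ 2 + η * ‖x‖ ^ 2 ≤ ⟪x, z⟫)
    (hmargin : ∀ p q : ℝ, κ * p ^ 2 ≤ c * p ^ 2 + ρ * q ^ 2 - a * q * (2 * p + ‖γ‖ * q))
    {s t : ℝ} (hs0 : 0 ≤ s) (hst : s ≤ t) :
    energy R γ (y t) (v t) ≤ energy R γ (y s) (v s) *
      Real.exp (-(min κ η / (3 / 2 + ‖γ‖ ^ 2 * ‖R‖ ^ 2)) * (t - s)) := by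
  set C₀ := 3 / 2 + ‖γ‖ ^ 2 * ‖R‖ ^ 2 with hC₀
  have hC₀pos : 0 < C₀ := by positivity
  set δ := min κ η / C₀ with hδ
  have hδpos : 0 < δ := div_pos (lt_min hκ hη) hC₀pos
  obtain ⟨L, hL⟩ := (isCompact_Icc (a := s) (b := t + 1)).exists_bound_of_continuousOn
    hs.continuous_v.continuousOn
  obtain ⟨N, hN⟩ := (isCompact_Icc (a := s) (b := t + 1)).exists_bound_of_continuousOn
    (R.continuous.comp hs.continuous_y).continuousOn
  have hL0 : 0 ≤ L := (norm_nonneg _).trans (hL s ⟨le_rfl, by linarith⟩)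
  have hN0 : 0 ≤ N := (norm_nonneg _).trans (hN s ⟨le_rfl, by linarith⟩)
  set C := 2 * a * L * (2 * L + ‖γ‖ * N) with hC
  have hC0 : 0 ≤ C := by positivity
  have key : ∀ h ∈ Ioc (0 : ℝ) 1, energy R γ (forwardAvg h y t) (forwardAvg h v t) ≤
      energy R γ (forwardAvg h y s) (forwardAvg h v s) * Real.exp (-δ * (t - s)) +
        C * h * (t - s) := by
    intro h hh
    choose z hz hzle using fun r => hγV (forwardAvg h y r)
    refine le_exp_mul_add_of_deriv_le hδpos.le (mul_nonneg hC0 hh.1.le) hst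
      (fun r hr => hasDerivAt_energy_forwardAvg hR hs hh.1 (hs0.trans hr.1) (hz r))
      fun r hr => ?_
    have hr0 : 0 ≤ r := hs0.trans hr.1
    have hsub : ∀ τ ∈ Icc r (r + h), τ ∈ Icc s (t + 1) := fun τ hτ =>
      ⟨hr.1.trans hτ.1, hτ.2.trans (add_le_add hr.2 hh.2)⟩
    have hG := norm_forwardAvg_forcing_le hs ha hg hh.1 hr0 fun τ hτ => hL τ (hsub τ hτ)
    have hV : ‖forwardAvg h v r‖ ≤ L := norm_forwardAvg_le hh.1
      (Eventually.of_forall fun τ hτ => hL τ (hsub τ (Ioc_subset_Icc_self hτ)))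
    have hU : ‖R (forwardAvg h y r)‖ ≤ N := by
      rw [map_forwardAvg R (hs.continuous_y.intervalIntegrable _ _)]
      exact norm_forwardAvg_le hh.1
        (Eventually.of_forall fun τ hτ => hN τ (hsub τ (Ioc_subset_Icc_self hτ)))
    -- The averaged velocity is in the range of `R`, where `γ` is assumed to be coercive.
    have hγv : c * ‖forwardAvg h v r‖ ^ 2 ≤ ⟪γ (forwardAvg h v r), forwardAvg h v r⟫ := by
      have hRd : R (h⁻¹ • (y (r + h) - y r)) = forwardAvg h v r := by
        rw [map_smul, map_sub, hs.position r (r + h) hr0 (by linarith [hh.1]), forwardAvg]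
      rw [← hRd]
      exact hγ _
    have hzr := hzle r
    have hE := energy_le R γ (forwardAvg h y r) (forwardAvg h v r)
    have hin : -⟪forwardAvg h g r, (2 : ℝ) • forwardAvg h v r + γ (R (forwardAvg h y r))⟫ ≤
        ‖forwardAvg h g r‖ * (2 * ‖forwardAvg h v r‖ + ‖γ‖ * ‖R (forwardAvg h y r)‖) := by
      refine (neg_le_abs _).trans ((abs_real_inner_le_norm _ _).trans ?_)
      gcongr
      refine (norm_add_le _ _).trans ?_
      rw [norm_smul, Real.norm_of_nonneg (by norm_num)]
      gcongr
      exact γ.le_opNorm _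
    generalize forwardAvg h y r = Y at *
    generalize forwardAvg h v r = V at *
    have hm := hmargin ‖V‖ ‖R Y‖
    have hδE : δ * energy R γ Y V ≤ min κ η * (‖Y‖ ^ 2 + ‖V‖ ^ 2) := by
      rw [hδ, div_mul_eq_mul_div, div_le_iff₀ hC₀pos, mul_assoc, mul_comm _ C₀]
      have : 0 ≤ min κ η := (lt_min hκ hη).le
      gcongr
    have hmin : min κ η * (‖Y‖ ^ 2 + ‖V‖ ^ 2) ≤ η * ‖Y‖ ^ 2 + κ * ‖V‖ ^ 2 := by
      rw [mul_add]
      gcongr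
      · exact min_le_right _ _
      · exact min_le_left _ _
    have hp : ‖forwardAvg h g r‖ * (2 * ‖V‖ + ‖γ‖ * ‖R Y‖) ≤
        a * ‖R Y‖ * (2 * ‖V‖ + ‖γ‖ * ‖R Y‖) + C * h := by
      have h1 : ‖forwardAvg h g r‖ * (2 * ‖V‖ + ‖γ‖ * ‖R Y‖) ≤
          (a * ‖R Y‖ + 2 * a * L * h) * (2 * ‖V‖ + ‖γ‖ * ‖R Y‖) := by gcongr
      have h2 : 2 * a * L * h * (2 * ‖V‖ + ‖γ‖ * ‖R Y‖) ≤
          2 * a * L * h * (2 * L + ‖γ‖ * N) := by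
        have := hh.1.le
        gcongr
      rw [hC]
      linarith
    linarith
  refine le_of_tendsto_of_tendsto (tendsto_energy_forwardAvg R γ hs.continuous_y hs.continuous_v t)
    (?_ : Tendsto _ _ (𝓝 _)) (eventually_of_mem (Ioc_mem_nhdsGT one_pos) key)
  have h0 : Tendsto (fun h : ℝ => C * h * (t - s)) (𝓝[>] 0) (𝓝 (C * 0 * (t - s))) :=
    ((tendsto_id.const_mul C).mul_const _).mono_left nhdsWithin_le_nhds
  have := ((tendsto_energy_forwardAvg R γ hs.continuous_y hs.continuous_v s).mul_const
    (Real.exp (-δ * (t - s)))).add h0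
  simpa using this

end Energy

/-! ### Mild solutions in the coordinates `B^{1/2} u` and `u'` -/

section Solution

variable {H : Type*} [NormedAddCommGroup H] [InnerProductSpace ℝ H]

theorem inner_sqrtOp_comm [CompleteSpace H] {B : H →ₗ.[ℝ] H} (hB : IsSelfAdjoint B)
    (hc : IsCoerciveOp B)
    (x z : formDomain B) : ⟪sqrtOp B x, (z : H)⟫ = ⟪(x : H), sqrtOp B z⟫ := by
  have hS := (sqrtOp_spec hB hc).selfAdjoint
  have hf := LinearPMap.adjoint_isFormalAdjoint hS.dense_domain
  rw [LinearPMap.isSelfAdjoint_def.1 hS] at hf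
  exact hf x z

/-- The square root of a coercive self-adjoint operator has a bounded symmetric inverse. The
boundedness is the Hellinger–Toeplitz theorem. -/
theorem exists_inverse_sqrtOp [CompleteSpace H] {B : H →ₗ.[ℝ] H} (hB : IsSelfAdjoint B)
    (hc : IsCoerciveOp B) :
    ∃ R : H →L[ℝ] H, (∀ x z, ⟪R x, z⟫ = ⟪x, R z⟫) ∧
      (∀ v : formDomain B, R (sqrtOp B v) = v) ∧
      ∀ x, ∃ hx : R x ∈ formDomain B, sqrtOp B ⟨R x, hx⟩ = x := by
  obtain ⟨T, -, -, hT⟩ := exists_bounded_inverse hB hc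
  have hS := sqrtOp_spec hB hc
  have hinj : Function.Injective (sqrtOp B).toFun := by
    rw [← LinearMap.ker_eq_bot, LinearMap.ker_eq_bot']
    intro v hv
    have h1 : ((v : H), (0 : H)) ∈ B.graph :=
      (hS.comp_self _ _).2 ⟨0, (LinearPMap.mem_graph_iff _).2 ⟨v, rfl, hv⟩, Submodule.zero_mem _⟩
    rw [hT, map_zero] at h1
    exact Subtype.ext h1.symm
  have hsurj : Function.Surjective (sqrtOp B).toFun := fun x => by
    obtain ⟨w, -, h2⟩ := (hS.comp_self _ _).1 ((hT (T x) x).2 rfl)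
    obtain ⟨w', -, h4⟩ := (LinearPMap.mem_graph_iff _).1 h2
    exact ⟨w', h4⟩
  let e := LinearEquiv.ofBijective (sqrtOp B).toFun ⟨hinj, hsurj⟩
  have he : ∀ x, sqrtOp B (e.symm x) = x := fun x => e.apply_symm_apply x
  let R₀ : H →ₗ[ℝ] H := (formDomain B).subtype ∘ₗ e.symm.toLinearMap
  have hsym : R₀.IsSymmetric := fun x z => by
    have h := inner_sqrtOp_comm hB hc (e.symm x) (e.symm z)
    rw [he, he] at h
    exact h.symm
  refine ⟨⟨R₀, hsym.continuous⟩, hsym, fun v => ?_, fun x => ⟨(e.symm x).2, he x⟩⟩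
  exact congrArg Subtype.val (e.symm_apply_apply v)

theorem ae_norm_le_essSupNorm {A : ℝ → H →L[ℝ] H}
    (hA : MemLp A ⊤ (volume.restrict (Ici (0 : ℝ)))) : ∀ᵐ τ, 0 ≤ τ → ‖A τ‖ ≤ essSupNorm A := by
  have h1 : ∀ᵐ τ ∂(volume.restrict (Ici (0 : ℝ))), ‖A τ‖ ≤ essSupNorm A := by
    filter_upwards [ae_le_eLpNormEssSup (f := A) (μ := volume.restrict (Ici (0 : ℝ)))] with τ hτ
    rw [← eLpNorm_exponent_top] at hτ
    have := ENNReal.toReal_mono hA.eLpNorm_ne_top hτ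
    simpa [essSupNorm] using this
  exact (ae_restrict_iff' measurableSet_Ici).1 h1

/-- Mild solutions are integrated solutions. The functions `y` and `v` are extended to negative
times by their values at `0`, which makes them continuous on the whole line. -/
theorem IsMildSolution.isIntegratedSolution [CompleteSpace H] {B : H →ₗ.[ℝ] H}
    {A : ℝ → H →L[ℝ] H} {γ R : H →L[ℝ] H} (hR : ∀ x z, ⟪R x, z⟫ = ⟪x, R z⟫)
    (hRS : ∀ v : formDomain B, R (sqrtOp B v) = v)
    (hSR : ∀ x, ∃ hx : R x ∈ formDomain B, sqrtOp B ⟨R x, hx⟩ = x)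
    (hA : MemLp A ⊤ (volume.restrict (Ici (0 : ℝ)))) {u : ℝ → formDomain B} {u' : ℝ → H}
    (hu : IsMildSolution B A γ u u') :
    IsIntegratedSolution R γ (fun t => sqrtOp B (u (max t 0))) (fun t => u' (max t 0))
      (fun t => A t (u (max t 0))) := by
  have hmax : Continuous fun t : ℝ => max t 0 := continuous_id.max continuous_const
  have hy : Continuous fun t => sqrtOp B (u (max t 0)) :=
    hu.continuousOn_V.comp_continuous hmax fun t => mem_Ici.2 (le_max_right _ _)
  have hv : Continuous fun t => u' (max t 0) :=
    hu.continuousOn_deriv.comp_continuous hmax fun t => mem_Ici.2 (le_max_right _ _)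
  have hpos : Continuous fun t => (u (max t 0) : H) := by
    simpa only [Function.comp_def, hRS] using R.continuous.comp hy
  have hg : ∀ s t, 0 ≤ s → s ≤ t →
      IntervalIntegrable (fun τ => A τ (u (max τ 0))) volume s t := by
    intro s t hs hst
    rw [intervalIntegrable_iff_integrableOn_Ioc_of_le hst]
    have hsub : Ioc s t ⊆ Ici 0 := fun τ hτ => hs.trans hτ.1.le
    have hmeas : AEStronglyMeasurable (fun τ => A τ (u (max τ 0)))
        (volume.restrict (Ioc s t)) :=
      (ContinuousLinearMap.id ℝ (H →L[ℝ] H)).aestronglyMeasurable_comp₂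
        (hA.1.mono_measure (Measure.restrict_mono hsub le_rfl)) hpos.aestronglyMeasurable
    obtain ⟨N, hN⟩ := (isCompact_Icc (a := s) (b := t)).exists_bound_of_continuousOn
      hpos.continuousOn
    have : IsFiniteMeasure (volume.restrict (Ioc s t)) := ⟨by simp⟩
    refine Integrable.of_bound hmeas (essSupNorm A * N) ?_
    filter_upwards [ae_restrict_of_ae (ae_norm_le_essSupNorm hA),
      ae_restrict_mem measurableSet_Ioc] with τ hτ hτm
    exact (A τ).le_of_opNorm_le_of_le (hτ (hsub hτm)) (hN τ (Ioc_subset_Icc_self hτm))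
  refine ⟨hy, hv, hg, fun s t hs hst => ?_, fun s t hs hst => ?_⟩
  · simp only [hRS]
    refine (intervalIntegral.integral_eq_sub_of_hasDerivAt_of_le hst hpos.continuousOn
      (fun τ hτ => ?_) (hv.intervalIntegrable _ _)).symm
    have hτ0 : 0 < τ := hs.trans_lt hτ.1
    have h1 := (hu.hasDeriv τ hτ0.le).hasDerivAt (Ici_mem_nhds hτ0)
    rw [max_eq_left hτ0.le]
    refine h1.congr_of_eventuallyEq ?_
    filter_upwards [Ici_mem_nhds hτ0] with r hr
    rw [max_eq_left hr]
  · refine ext_inner_right ℝ fun z => ?_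
    obtain ⟨hz, hSz⟩ := hSR z
    set F : ℝ → ℝ := fun τ => ⟪sqrtOp B (u (max τ 0)), z⟫ + ⟪A τ (u (max τ 0)), R z⟫ +
      ⟪γ (u' (max τ 0)), R z⟫ with hF
    have hi : ∀ x : H, ∀ f : ℝ → H, IntervalIntegrable f volume s t →
        (∫ τ in s..t, ⟪f τ, x⟫) = ⟪∫ τ in s..t, f τ, x⟫ := fun x f hf => by
      have := (innerSL ℝ x).intervalIntegral_comp_comm hf
      simpa only [innerSL_apply_apply, real_inner_comm] using this
    have hint : ∀ x : H, ∀ f : ℝ → H, ∀ r q : ℝ, IntervalIntegrable f volume r q →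
        IntervalIntegrable (fun τ => ⟪f τ, x⟫) volume r q := fun x f r q hf =>
      ⟨Integrable.inner_const hf.1 x, Integrable.inner_const hf.2 x⟩
    have hFint : ∀ r q, 0 ≤ r → r ≤ q → IntervalIntegrable F volume r q := fun r q hr hrq =>
      ((hint _ _ _ _ (hy.intervalIntegrable _ _)).add (hint _ _ _ _ (hg r q hr hrq))).add
        (hint _ _ _ _ ((γ.continuous.comp hv).intervalIntegrable _ _))
    have heq : ∀ r, 0 ≤ r → ⟪u' r, R z⟫ = ⟪u' 0, R z⟫ - ∫ τ in (0 : ℝ)..r, F τ := by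
      intro r hr
      rw [hu.equation ⟨R z, hz⟩ r hr]
      congr 1
      refine intervalIntegral.integral_congr fun τ hτ => ?_
      rw [uIcc_of_le hr] at hτ
      simp only [hF, pairing, hSz, max_eq_left hτ.1]
    have hsub : ⟪u' t - u' s, R z⟫ = -∫ τ in s..t, F τ := by
      rw [inner_sub_left, heq t (hs.trans hst), heq s hs,
        ← intervalIntegral.integral_add_adjacent_intervals (hFint 0 s le_rfl hs)
          (hFint s t hs hst)]
      ring
    have hsplit : (∫ τ in s..t, F τ) = ⟪∫ τ in s..t, sqrtOp B (u (max τ 0)), z⟫ +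
        ⟪∫ τ in s..t, A τ (u (max τ 0)), R z⟫ + ⟪γ (∫ τ in s..t, u' (max τ 0)), R z⟫ := by
      have hγv : IntervalIntegrable (fun τ => γ (u' (max τ 0))) volume s t :=
        (γ.continuous.comp hv).intervalIntegrable _ _
      have hyi := hy.intervalIntegrable (μ := volume) s t
      rw [← γ.intervalIntegral_comp_comm (hv.intervalIntegrable _ _), ← hi _ _ hyi,
        ← hi _ _ (hg s t hs hst), ← hi _ _ hγv, ← intervalIntegral.integral_add
          (hint _ _ _ _ hyi) (hint _ _ _ _ (hg s t hs hst)),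
        ← intervalIntegral.integral_add
          ((hint _ _ _ _ hyi).add (hint _ _ _ _ (hg s t hs hst))) (hint _ _ _ _ hγv)]
    rw [hR, max_eq_left hs, max_eq_left (hs.trans hst), hsub, hsplit, inner_neg_left,
      inner_add_left, hR, inner_add_left]
    ring

end Solution

end HilbertEvolution

theorem theorem4p1 {H : Type*} [NormedAddCommGroup H] [InnerProductSpace ℝ H] [CompleteSpace H]
    (B : H →ₗ.[ℝ] H) (hB : IsSelfAdjoint B) (hBcoer : HilbertEvolution.IsCoerciveOp B)
    (A : ℝ → H →L[ℝ] H) (hA : MemLp A ⊤ (volume.restrict (Ici (0 : ℝ))))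
    (γ : H →L[ℝ] H) (c : ℝ) (hc : 0 < c)
    (hγcoer : ∀ v : HilbertEvolution.formDomain B, c * ‖(v : H)‖ ^ 2 ≤ ⟪γ v, (v : H)⟫)
    (hγV : HilbertEvolution.IsBoundedOnV B γ)
    (ρ η : ℝ) (hρ : 0 < ρ) (hη : 0 < η)
    (hBγ : ∀ (v : HilbertEvolution.formDomain B) (hv : γ v ∈ HilbertEvolution.formDomain B),
      ρ * ‖(v : H)‖ ^ 2 + η * HilbertEvolution.normV B v ^ 2 ≤
        HilbertEvolution.pairing B v ⟨γ v, hv⟩)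
    (hsmall : HilbertEvolution.essSupNorm A <
      √(c * ρ + c ^ 2 / 4 * ‖γ‖ ^ 2) - c / 2 * ‖γ‖) :
    ∃ δ M : ℝ, 0 < δ ∧ 0 < M ∧
      ∀ (u : ℝ → HilbertEvolution.formDomain B) (u' : ℝ → H),
        HilbertEvolution.IsMildSolution B A γ u u' →
        ∀ s t : ℝ, 0 ≤ s → s ≤ t →
          HilbertEvolution.normV B (u t) ^ 2 + ‖u' t‖ ^ 2 ≤
            M * (HilbertEvolution.normV B (u s) ^ 2 + ‖u' s‖ ^ 2) * Real.exp (-δ * (t - s)) := by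
  obtain ⟨R, hR, hRS, hSR⟩ := HilbertEvolution.exists_inverse_sqrtOp hB hBcoer
  have ha : 0 ≤ HilbertEvolution.essSupNorm A := ENNReal.toReal_nonneg
  obtain ⟨κ, hκ, hmargin⟩ :=
    HilbertEvolution.exists_velocity_margin hc ha (norm_nonneg γ) hsmall
  have hC₀ : 0 < 3 / 2 + ‖γ‖ ^ 2 * ‖R‖ ^ 2 := by positivity
  refine ⟨min κ η / (3 / 2 + ‖γ‖ ^ 2 * ‖R‖ ^ 2), 2 * (3 / 2 + ‖γ‖ ^ 2 * ‖R‖ ^ 2),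
    div_pos (lt_min hκ hη) hC₀, by positivity, fun u u' hu s t hs hst => ?_⟩
  have hγR : ∀ x, c * ‖R x‖ ^ 2 ≤ ⟪γ (R x), R x⟫ := fun x => by
    obtain ⟨hx, -⟩ := hSR x
    exact hγcoer ⟨R x, hx⟩
  have hγV' : ∀ x, ∃ z, R z = γ (R x) ∧ ρ * ‖R x‖ ^ 2 + η * ‖x‖ ^ 2 ≤ ⟪x, z⟫ := fun x => by
    obtain ⟨K, hK⟩ := hγV
    obtain ⟨hx, hSx⟩ := hSR x
    obtain ⟨hv, -⟩ := hK ⟨R x, hx⟩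
    refine ⟨HilbertEvolution.sqrtOp B ⟨γ (R x), hv⟩, hRS _, ?_⟩
    have h := hBγ ⟨R x, hx⟩ hv
    rwa [HilbertEvolution.normV, HilbertEvolution.pairing, hSx] at h
  have hg : ∀ᵐ τ, 0 ≤ τ → ‖A τ (u (max τ 0))‖ ≤ HilbertEvolution.essSupNorm A *
      ‖R (HilbertEvolution.sqrtOp B (u (max τ 0)))‖ := by
    filter_upwards [HilbertEvolution.ae_norm_le_essSupNorm hA] with τ hτ h0
    rw [hRS]
    exact (A τ).le_of_opNorm_le (hτ h0) _
  have hdecay := HilbertEvolution.energy_le_exp_mul hR (hu.isIntegratedSolution hR hRS hSR hA)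
    ha hκ hη hg hγR hγV' hmargin hs hst
  simp only [max_eq_left hs, max_eq_left (hs.trans hst)] at hdecay
  have h1 := HilbertEvolution.le_energy R γ (HilbertEvolution.sqrtOp B (u t)) (u' t)
  have h2 := HilbertEvolution.energy_le R γ (HilbertEvolution.sqrtOp B (u s)) (u' s)
  have h3 := mul_le_mul_of_nonneg_right h2
    (Real.exp_pos (-(min κ η / (3 / 2 + ‖γ‖ ^ 2 * ‖R‖ ^ 2)) * (t - s))).le
  simp only [HilbertEvolution.normV]
  linarith
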